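/- Let $\mathcal X,\mathcal U,\mathcal Y$ be complex Hilbert spaces and let $\left[\begin{smallmatrix}A\&B\\ C\&D\end{smallmatrix}\right]$ be a system node on $(\mathcal X,\mathcal U,\mathcal Y)$: $A\&B:\mathcal X\times\mathcal U\supset\operatorname{dom}(A\&B)\to\mathcal X$ is a closed linear operator; $C\&D:\operatorname{dom}(A\&B)\to\mathcal Y$ is linear and bounded with respect to the graph norm of $A\&B$; for every $u\in\mathcal U$ there is $x\in\mathcal X$ with $\binom xu\in\operatorname{dom}(A\&B)$; and the main operator $x\mapsto A\&B\binom x0$, with domain $\{x:\binom x0\in\operatorname{dom}(A\&B)\}$, generates a strongly continuous semigroup on $\mathcal X$. A classical trajectory on $[0,T]$ ($T>0$) is a triple $(x,u,y)\in C^1([0,T];\mathcal X)\times C([0,T];\mathcal U)\times C([0,T];\mathcal Y)$ with $\binom{x(t)}{u(t)}\in\operatorname{dom}(A\&B)$, $\dot x(t)=A\&B\binom{x(t)}{u(t)}$ and $y(t)=C\&D\binom{x(t)}{u(t)}$ for all $t\in[0,T]$. A generalized trajectory on $[0,T]$ is a limit of classical trajectories on $[0,T]$ in $C([0,T];\mathcal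 X)\times L^2([0,T];\mathcal U)\times L^2([0,T];\mathcal Y)$. A generalized trajectory on $\mathbb R_{\ge0}$ is a triple of functions on $\mathbb R_{\ge0}$ whose restriction to $[0,T]$ is a generalized trajectory on $[0,T]$ for every $T>0$. A system node is infinite-time well-posed if there is a constant $c$ such that, for all $T>0$, all its classical trajectories on $[0,T]$ satisfy $\|x(T)\|+\|y\|_{L^2([0,T])}\le c\,(\|x(0)\|+\|u\|_{L^2([0,T])})$. The given system node is state-feedback stabilizable if there is a linear map $F\&G:\operatorname{dom}(A\&B)\to\mathcal U$, bounded with respect to the graph norm, such that $M\binom xu=\binom{x}{u-F\&G\binom xu}$ is injective on $\operatorname{dom}(A\&B)$ and the closed loop $\left[\begin{smallmatrix}A\&B\\ C\&D\\ F\&G\end{smallmatrix}\right]M^{-1}$, with domain $M\operatorname{dom}(A\&B)$, is an infinite-time well-posed system node on $(\mathcal X,\mathcal U,\mathcal Y\times\mathcal U)$. Let $Q=Q^*$ and $R=R^*$ be bounded operators on $\mathcal Y$ and $\mathcal U$, let $S:\mathcal U\to\mathcal Y$ be bounded and linear, and put $$s(y,u)=\left\langle\binom yu,\begin{bmatrix}Q&S\\S^*&R\end{bmatrix}\binom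 yu\right\rangle_{\mathcal Y\times\mathcal U}.$$ Assume that $s(y,u)\ge0$ for all $y\in\mathcal Y$, $u\in\mathcal U$, and that the system node is state-feedback stabilizable. Define $\mathrm{Val}:\mathcal X\to[0,\infty]$ by $$\mathrm{Val}(x_0)=\inf\Big\{\int_0^\infty s(y(t),u(t))\,dt \;:\; (x,u,y)\text{ is a generalized trajectory on }\mathbb R_{\ge0}\text{ with }x(0)=x_0\Big\}.$$ **Proposition 5.5.** Let $(x,u,y)$ be a generalized trajectory on $\mathbb R_{\ge0}$ with $u\in L^2(\mathbb R_{\ge0};\mathcal U)$ and $y\in L^2(\mathbb R_{\ge0};\mathcal Y)$. Then $\lim_{t\to\infty}\mathrm{Val}(x(t))=0$. -/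

import Mathlib

open Set Filter Topology MeasureTheory
open scoped NNReal ENNReal

noncomputable section

namespace SysNode

section Semigroup

variable {X : Type*} [NormedAddCommGroup X] [InnerProductSpace ℂ X]

/-- The family `S` of bounded operators, indexed by `t ≥ 0`, is a strongly continuous semigroup. -/
structure IsC0Semigroup (S : ℝ≥0 → X →L[ℂ] X) : Prop where
  map_zero : S 0 = ContinuousLinearMap.id ℂ X
  map_add : ∀ s t : ℝ≥0, S (s + t) = (S s).comp (S t)
  continuous_orbit : ∀ x : X, Continuous fun t : ℝ≥0 => S t x

/-- `A` is the (infinitesimal) generator of `S`: the domain of `A` consists of exactly those `x`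
for which the limit of `(S h x - x) / h` as `h ↓ 0` exists, and `A x` is this limit. -/
def IsGenerator (S : ℝ≥0 → X →L[ℂ] X) (A : X →ₗ.[ℂ] X) : Prop :=
  ∀ x z : X, (x, z) ∈ A.graph ↔
    Tendsto (fun h : ℝ≥0 => (h : ℝ)⁻¹ • (S h x - x)) (𝓝[>] 0) (𝓝 z)

end Semigroup

section Node

variable {X U Y Z : Type*}
  [NormedAddCommGroup X] [InnerProductSpace ℂ X]
  [NormedAddCommGroup U] [InnerProductSpace ℂ U]
  [NormedAddCommGroup Y] [InnerProductSpace ℂ Y]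
  [NormedAddCommGroup Z] [InnerProductSpace ℂ Z]

/-- The graph norm on the domain of an operator `AB` from `X × U` to `X`, where `X × U` carries its
Hilbert space norm. -/
def graphNorm (AB : X × U →ₗ.[ℂ] X) (w : AB.domain) : ℝ :=
  √(‖(w : X × U).1‖ ^ 2 + ‖(w : X × U).2‖ ^ 2 + ‖AB w‖ ^ 2)

/-- Boundedness of a linear map on the domain of `AB`, with respect to the graph norm of `AB`. -/
def IsGraphBounded (AB : X × U →ₗ.[ℂ] X) (L : AB.domain →ₗ[ℂ] Z) : Prop :=
  ∃ c : ℝ, ∀ w : AB.domain, ‖L w‖ ≤ c * graphNorm AB w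

/-- The main operator: its domain is `{x | (x, 0) ∈ dom AB}`, and it maps `x` to `AB (x, 0)`. -/
def mainOperator (AB : X × U →ₗ.[ℂ] X) : X →ₗ.[ℂ] X where
  domain := AB.domain.comap (LinearMap.inl ℂ X U)
  toFun := AB.toFun ∘ₗ (LinearMap.inl ℂ X U).submoduleComap AB.domain

end Node

/-- A system node on `(X, U, Y)`. The fields `AB` and `CD` are the operators `A&B` and `C&D`; both
have the same domain, a subspace of `X × U`. (Closedness only depends on the product topology.) -/
structure SystemNode (X U Y : Type*)
    [NormedAddCommGroup X] [InnerProductSpace ℂ X]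
    [NormedAddCommGroup U] [InnerProductSpace ℂ U]
    [NormedAddCommGroup Y] [InnerProductSpace ℂ Y] where
  AB : X × U →ₗ.[ℂ] X
  CD : AB.domain →ₗ[ℂ] Y
  isClosed_AB : AB.IsClosed
  bounded_CD : IsGraphBounded AB CD
  exists_state : ∀ u : U, ∃ x : X, (x, u) ∈ AB.domain
  exists_semigroup : ∃ S : ℝ≥0 → X →L[ℂ] X, IsC0Semigroup S ∧ IsGenerator S (mainOperator AB)

section Trajectories

variable {X U Y : Type*}
  [NormedAddCommGroup X] [InnerProductSpace ℂ X]
  [NormedAddCommGroup U] [InnerProductSpace ℂ U]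
  [NormedAddCommGroup Y] [InnerProductSpace ℂ Y]

/-- Classical trajectories on `[0, T]`. Only the values of `x`, `u`, `y` on `[0, T]` matter. -/
structure IsClassicalTrajectoryOn (N : SystemNode X U Y) (T : ℝ)
    (x : ℝ → X) (u : ℝ → U) (y : ℝ → Y) : Prop where
  contDiffOn_state : ContDiffOn ℝ 1 x (Icc 0 T)
  continuousOn_input : ContinuousOn u (Icc 0 T)
  continuousOn_output : ContinuousOn y (Icc 0 T)
  equation : ∀ t ∈ Icc 0 T, ∃ h : (x t, u t) ∈ N.AB.domain,
    HasDerivWithinAt x (N.AB ⟨(x t, u t), h⟩) (Icc 0 T) t ∧ y t = N.CD ⟨(x t, u t), h⟩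

/-- Generalized trajectories on `[0, T]`: limits of classical trajectories on `[0, T]` in
`C([0, T]; X) × L²([0, T]; U) × L²([0, T]; Y)`. Elements of `L²` are given by representatives. -/
structure IsGeneralizedTrajectoryOn (N : SystemNode X U Y) (T : ℝ)
    (x : ℝ → X) (u : ℝ → U) (y : ℝ → Y) : Prop where
  continuousOn_state : ContinuousOn x (Icc 0 T)
  memLp_input : MemLp u 2 (volume.restrict (Icc 0 T))
  memLp_output : MemLp y 2 (volume.restrict (Icc 0 T))
  isLimit : ∃ (xn : ℕ → ℝ → X) (un : ℕ → ℝ → U) (yn : ℕ → ℝ → Y),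
    (∀ n, IsClassicalTrajectoryOn N T (xn n) (un n) (yn n)) ∧
    TendstoUniformlyOn xn x atTop (Icc 0 T) ∧
    Tendsto (fun n => eLpNorm (un n - u) 2 (volume.restrict (Icc 0 T))) atTop (𝓝 0) ∧
    Tendsto (fun n => eLpNorm (yn n - y) 2 (volume.restrict (Icc 0 T))) atTop (𝓝 0)

/-- Generalized trajectories on `[0, ∞)`. Only the values of `x`, `u`, `y` on `[0, ∞)` matter. -/
def IsGeneralizedTrajectory (N : SystemNode X U Y)
    (x : ℝ → X) (u : ℝ → U) (y : ℝ → Y) : Prop :=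
  ∀ T : ℝ, 0 < T → IsGeneralizedTrajectoryOn N T x u y

/-- Infinite-time well-posedness: the well-posedness estimate on `[0, T]` holds for all classical
trajectories, with a constant that does not depend on `T`. -/
def IsInfiniteTimeWellPosed (N : SystemNode X U Y) : Prop :=
  ∃ c : ℝ≥0, ∀ T : ℝ, 0 < T → ∀ (x : ℝ → X) (u : ℝ → U) (y : ℝ → Y),
    IsClassicalTrajectoryOn N T x u y →
      ‖x T‖ₑ + eLpNorm y 2 (volume.restrict (Icc 0 T)) ≤
        c * (‖x 0‖ₑ + eLpNorm u 2 (volume.restrict (Icc 0 T)))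

/-- The operator `(x, u) ↦ (x, u - FG (x, u))` on the domain of `A&B`; it expresses the external
input `v = u - z` of the closed loop, where `z = FG (x, u)`. -/
def feedbackMap (N : SystemNode X U Y) (FG : N.AB.domain →ₗ[ℂ] U) : N.AB.domain →ₗ[ℂ] X × U :=
  N.AB.domain.subtype - LinearMap.inr ℂ X U ∘ₗ FG

/-- `FG` is an admissible state feedback for `N`, and `K` is the resulting closed-loop system node,
with input `v` and output `(y, z)`: `FG` is bounded on `dom(A&B)`, the operator
`M = feedbackMap N FG` is a bijection from `dom(A&B)` onto the domain of the closed loop, and the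
closed-loop operators are `A&B`, `C&D`, `FG` composed with the inverse of `M`. -/
structure IsClosedLoop (N : SystemNode X U Y) (FG : N.AB.domain →ₗ[ℂ] U)
    (K : SystemNode X U (WithLp 2 (Y × U))) : Prop where
  bounded_FG : IsGraphBounded N.AB FG
  injective : Function.Injective (feedbackMap N FG)
  range_eq : LinearMap.range (feedbackMap N FG) = K.AB.domain
  state_eq : ∀ (w : N.AB.domain) (h : feedbackMap N FG w ∈ K.AB.domain),
    K.AB ⟨feedbackMap N FG w, h⟩ = N.AB w
  output_eq : ∀ (w : N.AB.domain) (h : feedbackMap N FG w ∈ K.AB.domain),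
    K.CD ⟨feedbackMap N FG w, h⟩ = WithLp.toLp 2 (N.CD w, FG w)

/-- State-feedback stabilizability: some admissible state feedback yields an infinite-time
well-posed closed-loop system. -/
def IsStateFeedbackStabilizable (N : SystemNode X U Y) : Prop :=
  ∃ (FG : N.AB.domain →ₗ[ℂ] U) (K : SystemNode X U (WithLp 2 (Y × U))),
    IsClosedLoop N FG K ∧ IsInfiniteTimeWellPosed K

end Trajectories

section Cost

variable {X U Y : Type*}
  [NormedAddCommGroup X] [InnerProductSpace ℂ X]
  [NormedAddCommGroup U] [InnerProductSpace ℂ U] [CompleteSpace U]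
  [NormedAddCommGroup Y] [InnerProductSpace ℂ Y] [CompleteSpace Y]

/-- The supply rate `s(y, u) = ⟨(y, u), [Q S; S* R] (y, u)⟩` on `Y × U`. The inner product is real
for self-adjoint `Q`, `R`. -/
def supplyRate (Q : Y →L[ℂ] Y) (S : U →L[ℂ] Y) (R : U →L[ℂ] U) (y : Y) (u : U) : ℝ :=
  (inner ℂ y (Q y + S u) + inner ℂ u (ContinuousLinearMap.adjoint S y + R u)).re

/-- The cost `∫₀^∞ s(y(t), u(t)) dt ∈ [0, ∞]`, for nonnegative supply rates `s`. -/
def cost (Q : Y →L[ℂ] Y) (S : U →L[ℂ] Y) (R : U →L[ℂ] U) (y : ℝ → Y) (u : ℝ → U) : ℝ≥0∞ :=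
  ∫⁻ t in Ici (0 : ℝ), ENNReal.ofReal (supplyRate Q S R (y t) (u t))

/-- The value function: the infimum in `[0, ∞]` of the cost over all generalized trajectories on
`[0, ∞)` that start at `x₀`. -/
def Val (N : SystemNode X U Y) (Q : Y →L[ℂ] Y) (S : U →L[ℂ] Y) (R : U →L[ℂ] U) (x₀ : X) : ℝ≥0∞ :=
  sInf {J : ℝ≥0∞ | ∃ (x : ℝ → X) (u : ℝ → U) (y : ℝ → Y),
    IsGeneralizedTrajectory N x u y ∧ x 0 = x₀ ∧ J = cost Q S R y u}

end Cost

end SysNode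

end

namespace SysNode

section TimeShift

/-! The dynamics are time-invariant: restarting a generalized trajectory at time `a ≥ 0` gives a
competitor in the infimum defining `Val` at `x a`. Hence `Val` at `x a` is at most the cost
accumulated on `[a, ∞)` (`Val_le_tail_cost`). The supply rate is quadratic with bounded
coefficients, so square integrable `u` and `y` have finite total cost (`integrable_supplyRate`), and
the tails of a finite integral vanish (`tendsto_setLIntegral_Ici_atTop`). A squeeze finishes the
proof; no regularity of `Val` is involved. -/

lemma measurePreserving_shift_restrict_Icc (a T : ℝ) :
    MeasurePreserving (fun s : ℝ => a + s) (volume.restrict (Icc 0 T))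
      (volume.restrict (Icc a (a + T))) := by
  have h := (measurePreserving_add_left (volume : Measure ℝ) a).restrict_preimage_emb
    (MeasurableEquiv.addLeft a).measurableEmbedding (Icc a (a + T))
  simpa using h

lemma measurePreserving_shift_restrict_Ici (a : ℝ) :
    MeasurePreserving (fun s : ℝ => a + s) (volume.restrict (Ici 0)) (volume.restrict (Ici a)) := by
  have h := (measurePreserving_add_left (volume : Measure ℝ) a).restrict_preimage_emb
    (MeasurableEquiv.addLeft a).measurableEmbedding (Ici a)
  simpa using h

lemma mapsTo_shift_Icc {a T : ℝ} (ha : 0 ≤ a) :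
    MapsTo (fun s : ℝ => a + s) (Icc 0 T) (Icc 0 (a + T)) := fun s hs =>
  ⟨by linarith [hs.1], by linarith [hs.2]⟩

lemma memLp_shift {E : Type*} [NormedAddCommGroup E] {f : ℝ → E} {a T : ℝ} (ha : 0 ≤ a)
    (hf : MemLp f 2 (volume.restrict (Icc 0 (a + T)))) :
    MemLp (fun s => f (a + s)) 2 (volume.restrict (Icc 0 T)) :=
  (hf.mono_measure (Measure.restrict_mono (Icc_subset_Icc_left ha) le_rfl)).comp_measurePreserving
    (measurePreserving_shift_restrict_Icc a T)

lemma eLpNorm_shift_le {E : Type*} [NormedAddCommGroup E] {f : ℝ → E} {a T : ℝ} (ha : 0 ≤ a) :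
    eLpNorm (fun s => f (a + s)) 2 (volume.restrict (Icc 0 T)) ≤
      eLpNorm f 2 (volume.restrict (Icc 0 (a + T))) := by
  -- Transporting the norm along a measurable embedding requires no measurability of `f`.
  have hemb : MeasurableEmbedding fun s : ℝ => a + s :=
    (MeasurableEquiv.addLeft a).measurableEmbedding
  have h := hemb.eLpNorm_map_measure (g := f) (p := 2) (μ := volume.restrict (Icc 0 T))
  rw [(measurePreserving_shift_restrict_Icc a T).map_eq] at h
  calc eLpNorm (fun s => f (a + s)) 2 (volume.restrict (Icc 0 T))
      = eLpNorm f 2 (volume.restrict (Icc a (a + T))) := h.symm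
    _ ≤ _ := eLpNorm_mono_measure _ (Measure.restrict_mono (Icc_subset_Icc_left ha) le_rfl)

variable {X U Y : Type*}
  [NormedAddCommGroup X] [InnerProductSpace ℂ X]
  [NormedAddCommGroup U] [InnerProductSpace ℂ U]
  [NormedAddCommGroup Y] [InnerProductSpace ℂ Y]
  {N : SystemNode X U Y} {x : ℝ → X} {u : ℝ → U} {y : ℝ → Y} {a T : ℝ}

lemma IsClassicalTrajectoryOn.shift (ha : 0 ≤ a)
    (h : IsClassicalTrajectoryOn N (a + T) x u y) :
    IsClassicalTrajectoryOn N T (fun s => x (a + s)) (fun s => u (a + s))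
      (fun s => y (a + s)) where
  contDiffOn_state := h.contDiffOn_state.comp
    (contDiff_const.add contDiff_id).contDiffOn (mapsTo_shift_Icc ha)
  continuousOn_input := h.continuousOn_input.comp (by fun_prop) (mapsTo_shift_Icc ha)
  continuousOn_output := h.continuousOn_output.comp (by fun_prop) (mapsTo_shift_Icc ha)
  equation t ht := by
    obtain ⟨hdom, hderiv, hout⟩ := h.equation (a + t) (mapsTo_shift_Icc ha ht)
    refine ⟨hdom, ?_, hout⟩
    have hshift : HasDerivWithinAt (fun s : ℝ => a + s) 1 (Icc 0 T) t :=
      (hasDerivWithinAt_id t _).const_add a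
    simpa [Function.comp_def] using hderiv.scomp t hshift (mapsTo_shift_Icc ha)

/-- Translating an approximating sequence suffices: the translated errors on `[0, T]` are the
original ones on `[a, a + T]`, hence dominated by those on `[0, a + T]`. -/
lemma IsGeneralizedTrajectoryOn.shift (ha : 0 ≤ a)
    (h : IsGeneralizedTrajectoryOn N (a + T) x u y) :
    IsGeneralizedTrajectoryOn N T (fun s => x (a + s)) (fun s => u (a + s))
      (fun s => y (a + s)) where
  continuousOn_state := h.continuousOn_state.comp (by fun_prop) (mapsTo_shift_Icc ha)
  memLp_input := memLp_shift ha h.memLp_input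
  memLp_output := memLp_shift ha h.memLp_output
  isLimit := by
    obtain ⟨xn, un, yn, hcl, hx, hu, hy⟩ := h.isLimit
    exact ⟨fun n s => xn n (a + s), fun n s => un n (a + s), fun n s => yn n (a + s),
      fun n => (hcl n).shift ha,
      (hx.comp fun s => a + s).mono (mapsTo_shift_Icc ha),
      tendsto_of_tendsto_of_tendsto_of_le_of_le tendsto_const_nhds hu (fun _ => zero_le)
        fun n => eLpNorm_shift_le (f := un n - u) ha,
      tendsto_of_tendsto_of_tendsto_of_le_of_le tendsto_const_nhds hy (fun _ => zero_le)
        fun n => eLpNorm_shift_le (f := yn n - y) ha⟩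

lemma IsGeneralizedTrajectory.shift (ha : 0 ≤ a) (h : IsGeneralizedTrajectory N x u y) :
    IsGeneralizedTrajectory N (fun s => x (a + s)) (fun s => u (a + s)) (fun s => y (a + s)) :=
  fun T hT => (h (a + T) (by linarith)).shift ha

end TimeShift

section Cost

lemma integrable_inner_of_memLp {α E : Type*} [MeasurableSpace α] {μ : Measure α}
    [NormedAddCommGroup E] [InnerProductSpace ℂ E] {f g : α → E}
    (hf : MemLp f 2 μ) (hg : MemLp g 2 μ) : Integrable (fun t => inner ℂ (f t) (g t)) μ :=
  (L2.integrable_inner (𝕜 := ℂ) (hf.toLp f) (hg.toLp g)).congr <| by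
    filter_upwards [hf.coeFn_toLp, hg.coeFn_toLp] with t h1 h2
    rw [h1, h2]

variable {X U Y : Type*}
  [NormedAddCommGroup X] [InnerProductSpace ℂ X]
  [NormedAddCommGroup U] [InnerProductSpace ℂ U] [CompleteSpace U]
  [NormedAddCommGroup Y] [InnerProductSpace ℂ Y] [CompleteSpace Y]
  (Q : Y →L[ℂ] Y) (S : U →L[ℂ] Y) (R : U →L[ℂ] U)

/-- Bounded operators preserve L², and the inner product of two L² functions is integrable. -/
lemma integrable_supplyRate {α : Type*} [MeasurableSpace α] {μ : Measure α} {y : α → Y} {u : α → U}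
    (hy : MemLp y 2 μ) (hu : MemLp u 2 μ) :
    Integrable (fun t => supplyRate Q S R (y t) (u t)) μ := by
  have h1 : Integrable (fun t => inner ℂ (y t) (Q (y t) + S (u t))) μ :=
    integrable_inner_of_memLp hy ((Q.comp_memLp' hy).add (S.comp_memLp' hu))
  have h2 : Integrable (fun t => inner ℂ (u t)
      (ContinuousLinearMap.adjoint S (y t) + R (u t))) μ :=
    integrable_inner_of_memLp hu (((ContinuousLinearMap.adjoint S).comp_memLp' hy).add (R.comp_memLp' hu))
  exact (h1.add h2).re

lemma cost_shift (a : ℝ) (y : ℝ → Y) (u : ℝ → U) :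
    cost Q S R (fun s => y (a + s)) (fun s => u (a + s)) =
      ∫⁻ t in Ici a, ENNReal.ofReal (supplyRate Q S R (y t) (u t)) :=
  (measurePreserving_shift_restrict_Ici a).lintegral_comp_emb
    (MeasurableEquiv.addLeft a).measurableEmbedding
    fun t => ENNReal.ofReal (supplyRate Q S R (y t) (u t))

lemma Val_le_tail_cost {N : SystemNode X U Y} {x : ℝ → X} {u : ℝ → U} {y : ℝ → Y}
    (h : IsGeneralizedTrajectory N x u y) {a : ℝ} (ha : 0 ≤ a) :
    Val N Q S R (x a) ≤ ∫⁻ t in Ici a, ENNReal.ofReal (supplyRate Q S R (y t) (u t)) :=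
  sInf_le ⟨_, _, _, h.shift ha, by simp, (cost_shift Q S R a y u).symm⟩

end Cost

/-- This is continuity from above of the measure with density `f` along the half-lines `Ici t`,
which decrease to the empty set; `hf` provides the one set of finite measure that it needs.
Measurability of `f` plays no role, since the half-lines are measurable. -/
lemma tendsto_setLIntegral_Ici_atTop {f : ℝ → ℝ≥0∞} {a : ℝ} (hf : ∫⁻ t in Ici a, f t ≠ ∞) :
    Tendsto (fun t => ∫⁻ s in Ici t, f s) atTop (𝓝 0) := by
  have hν : Tendsto (fun t : ℝ => volume.withDensity f (Ici t)) atTop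
      (𝓝 (volume.withDensity f (⋂ t : ℝ, Ici t))) :=
    tendsto_measure_iInter_atTop (fun t => measurableSet_Ici.nullMeasurableSet)
      antitone_Ici ⟨a, by rwa [withDensity_apply _ measurableSet_Ici]⟩
  have hempty : (⋂ t : ℝ, Ici t) = ∅ := by
    ext s
    simpa using exists_gt s
  rw [hempty, measure_empty] at hν
  simpa only [withDensity_apply _ measurableSet_Ici] using hν

end SysNode

theorem proposition5p5
    {X U Y : Type*}
    [NormedAddCommGroup X] [InnerProductSpace ℂ X] [CompleteSpace X]
    [NormedAddCommGroup U] [InnerProductSpace ℂ U] [CompleteSpace U]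
    [NormedAddCommGroup Y] [InnerProductSpace ℂ Y] [CompleteSpace Y]
    (N : SysNode.SystemNode X U Y)
    (Q : Y →L[ℂ] Y) (S : U →L[ℂ] Y) (R : U →L[ℂ] U)
    (hQ : IsSelfAdjoint Q) (hR : IsSelfAdjoint R)
    (hs : ∀ (y : Y) (u : U), 0 ≤ SysNode.supplyRate Q S R y u)
    (hstab : SysNode.IsStateFeedbackStabilizable N)
    (x : ℝ → X) (u : ℝ → U) (y : ℝ → Y)
    (htraj : SysNode.IsGeneralizedTrajectory N x u y)
    (hu : MemLp u 2 (volume.restrict (Ici (0 : ℝ))))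
    (hy : MemLp y 2 (volume.restrict (Ici (0 : ℝ)))) :
    Tendsto (fun t : ℝ => SysNode.Val N Q S R (x t)) atTop (𝓝 0) := by
  have hcost : ∫⁻ t in Ici (0 : ℝ), ENNReal.ofReal (SysNode.supplyRate Q S R (y t) (u t)) ≠ ∞ :=
    (SysNode.integrable_supplyRate Q S R hy hu).lintegral_lt_top.ne
  refine tendsto_of_tendsto_of_tendsto_of_le_of_le' tendsto_const_nhds
    (SysNode.tendsto_setLIntegral_Ici_atTop hcost) (Eventually.of_forall fun _ => zero_le) ?_
  -- The tail bound is available only for `a ≥ 0`, where the trajectory lives.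
  filter_upwards [eventually_ge_atTop 0] with a ha
  exact SysNode.Val_le_tail_cost Q S R htraj ha
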